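/- For a real number $\xi$ and an integer $N\ge 1$, let $\lambda_N(\xi)$ be the supremum of the real numbers $\lambda$ such that the system $$1\le |x|\le X,\qquad \max_{1\le j\le N}|\xi^j x-y_j|\le X^{-\lambda}$$ has a solution $(x,y_1,\dots,y_N)\in\mathbb{Z}^{N+1}$ for arbitrarily large $X$. Let $w_N(\xi)$ (respectively $\widehat w_N(\xi)$) be the supremum of the real numbers $w$ such that the system $$\max_{1\le j\le N}|x_j|\le X,\qquad 0<|x_0+\xi x_1+\cdots+\xi^N x_N|\le X^{-w}$$ has a solution $(x_0,\dots,x_N)\in\mathbb{Z}^{N+1}$ for arbitrarily large $X$ (respectively for all sufficiently large $X$). These suprema are taken in $[-\infty,\infty]$. Theorem. Let $k,n$ be integers with $2\le n\le k\le 2n-2$ and let $\xi$ be a real number with $w_n(\xi)>w_{n-1}(\xi)$. Then $\widehat w_n(\xi)$ is finite and $$\lambda_k(\xi)\ \ge\ \frac{w_n(\xi)\widehat w_n(\xi)+(n-k-1)\,w_n(\xi)+(n-k)\,\widehat w_n(\xi)}{(2n-k-2)\,w_n(\xi)\widehat w_n(\xi)+(k-n+1)\,w_n(\xi)+(n-1)\,\widehat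 w_n(\xi)},$$ where, if $w_n(\xi)=\infty$, the right-hand side is understood as its limit as $w_n(\xi)\to\infty$ with $\widehat w_n(\xi)$ fixed, that is, as $$\frac{\widehat w_n(\xi)+n-k-1}{(2n-k-2)\,\widehat w_n(\xi)+k-n+1}.$$ -/

import Mathlib

open Filter

noncomputable section

/-- For the bound `X` and the exponent `l`: some integer vector `(x, y₁, …, y_N)` has
`1 ≤ |x| ≤ X` and `|ξ_j x - y_j| ≤ X ^ (-l)` for all `j`. -/
def SimultSolvable {N : ℕ} (ξ : Fin N → ℝ) (l X : ℝ) : Prop :=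
  ∃ (x : ℤ) (y : Fin N → ℤ), 1 ≤ |(x : ℝ)| ∧ |(x : ℝ)| ≤ X ∧
    ∀ j, |ξ j * (x : ℝ) - (y j : ℝ)| ≤ X ^ (-l)

/-- For the bound `X` and the exponent `w`: some integer vector `(x₀, x₁, …, x_N)` has
`|x_j| ≤ X` for `1 ≤ j ≤ N` and `0 < |x₀ + ξ₁ x₁ + ⋯ + ξ_N x_N| ≤ X ^ (-w)`. -/
def LinFormSolvable {N : ℕ} (ξ : Fin N → ℝ) (w X : ℝ) : Prop :=
  ∃ (x₀ : ℤ) (x : Fin N → ℤ), (∀ j, |(x j : ℝ)| ≤ X) ∧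
    0 < |(x₀ : ℝ) + ∑ j, ξ j * (x j : ℝ)| ∧
    |(x₀ : ℝ) + ∑ j, ξ j * (x j : ℝ)| ≤ X ^ (-w)

/-- The point `(t, t², …, t^N)` of the Veronese curve. -/
def veronese (N : ℕ) (t : ℝ) : Fin N → ℝ := fun j => t ^ ((j : ℕ) + 1)

/-- The ordinary exponent of simultaneous approximation `λ_N(t)`, in `[-∞, ∞]`. -/
def lambdaExp (N : ℕ) (t : ℝ) : EReal :=
  sSup ((fun l : ℝ => (l : EReal)) '' {l : ℝ | ∃ᶠ X in atTop, SimultSolvable (veronese N t) l X})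

/-- The ordinary exponent of linear form approximation `w_N(t)`, in `[-∞, ∞]`. -/
def wExp (N : ℕ) (t : ℝ) : EReal :=
  sSup ((fun w : ℝ => (w : EReal)) '' {w : ℝ | ∃ᶠ X in atTop, LinFormSolvable (veronese N t) w X})

/-- The uniform exponent of linear form approximation `ŵ_N(t)`, in `[-∞, ∞]`. -/
def wHatExp (N : ℕ) (t : ℝ) : EReal :=
  sSup ((fun w : ℝ => (w : EReal)) '' {w : ℝ | ∀ᶠ X in atTop, LinFormSolvable (veronese N t) w X})

end

/-! Put s = k + 1 - n, and let θ, φ be slightly larger than 1/w_n(ξ) and 1/ŵ_n(ξ). Integer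
polynomials realising w_n(ξ) cannot split into two factors of degree below n: each factor obeys a
Liouville bound with an exponent between w_{n-1}(ξ) and w_n(ξ), and Mahler measure is
multiplicative. So there are irreducible P of degree n with very small P(ξ)
(`exists_irreducible_of_wExp_lt`). The uniform exponent supplies Q of degree at most n with 0 <
|Q(ξ)| < |P(ξ)|. Such a Q is not a multiple of P, hence is coprime to it. With B = 1/|P(ξ)| the
heights are O(B^θ) and O(B^φ) (`hasSmallCoprimePairs_of_wExp_lt`).

The 2s polynomials X^i P, X^i Q with i < s have degree at most k and, read as linear forms on
ℤ^(k+1), are independent. They are small at (1, ξ, …, ξ^k), so Minkowski's theorem yields a nonzero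
integer vector v killed by all of them and close to the line through that point
(`exists_int_vec_of_coprime_polynomials`). One gets |v_0| ≪ B^(1+θ-η) with errors ≪ B^(-η) for every
η < (1+θ-sθ-sφ)/(n-s), and the limiting ratio η/(1+θ-η) is the claimed bound. For s = n the forms
have no common zero but 0. This excludes small coprime pairs with θ, φ too small, so ŵ_n(ξ) is
finite. -/

/-! ### Geometry of numbers: short integer points in the kernel of integer forms -/

open MeasureTheory Module in
/-- **Minkowski's theorem on linear forms**, with all bounds equal to one. -/
theorem exists_int_vec_abs_mulVec_lt_one {ι : Type*} [Fintype ι] [DecidableEq ι]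
    (A : Matrix ι ι ℝ) (h0 : A.det ≠ 0) (h1 : |A.det| < 1) :
    ∃ v : ι → ℤ, v ≠ 0 ∧ ∀ i, |(A.mulVec fun j => (v j : ℝ)) i| < 1 := by
  let b := Pi.basisFun ℝ ι
  have fund := ZSpan.isAddFundamentalDomain' b (volume : Measure (ι → ℝ))
  let K : Set (ι → ℝ) := Set.pi Set.univ fun _ => Set.Ioo (-1 : ℝ) 1
  have hdet : LinearMap.det (Matrix.toLin' A) ≠ 0 := by simpa using h0
  have hvol : volume (Matrix.toLin' A ⁻¹' K)
      = ENNReal.ofReal |A.det|⁻¹ * 2 ^ Fintype.card ι := by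
    rw [Measure.addHaar_preimage_linearMap _ hdet, LinearMap.det_toLin', abs_inv,
      Real.volume_pi_Ioo]
    congr 1
    simp only [Finset.prod_const, Finset.card_univ]
    norm_num
  have hF : volume (ZSpan.fundamentalDomain b) = 1 := by
    rw [ZSpan.volume_fundamentalDomain]
    have : (Matrix.of b : Matrix ι ι ℝ) = 1 := by
      ext i j
      simp [b, Matrix.one_apply, Pi.single_apply, eq_comm]
    simp [this]
  have hlt : volume (ZSpan.fundamentalDomain b) * 2 ^ finrank ℝ (ι → ℝ)
      < volume (Matrix.toLin' A ⁻¹' K) := by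
    rw [hvol, hF, one_mul, finrank_fintype_fun_eq_card]
    have h3 : (1 : ENNReal) < ENNReal.ofReal |A.det|⁻¹ := by
      rw [← ENNReal.ofReal_one, ENNReal.ofReal_lt_ofReal_iff (by positivity)]
      exact (one_lt_inv₀ (abs_pos.2 h0)).2 h1
    calc (2 : ENNReal) ^ Fintype.card ι = 1 * 2 ^ Fintype.card ι := (one_mul _).symm
      _ < _ := by
        apply ENNReal.mul_lt_mul_left (by simp) (by simp) h3
  have hsymm : ∀ x ∈ Matrix.toLin' A ⁻¹' K, -x ∈ Matrix.toLin' A ⁻¹' K := by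
    intro x hx
    simp only [K, Set.mem_preimage, Set.mem_pi, Set.mem_univ, forall_const, Set.mem_Ioo, map_neg,
      Pi.neg_apply] at hx ⊢
    intro i
    constructor <;> linarith [(hx i).1, (hx i).2]
  have hconv : Convex ℝ (Matrix.toLin' A ⁻¹' K) :=
    (convex_pi fun _ _ => convex_Ioo _ _).linear_preimage _
  have : Countable (Submodule.span ℤ (Set.range b)).toAddSubgroup :=
    inferInstanceAs (Countable (Submodule.span ℤ (Set.range b)))
  obtain ⟨⟨x, hxL⟩, hx0, hxK⟩ :=
    exists_ne_zero_mem_lattice_of_measure_mul_two_pow_lt_measure fund hsymm hconv hlt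
  have hint : ∀ i, ∃ z : ℤ, (z : ℝ) = x i := by
    intro i
    have := (b.mem_span_iff_repr_mem ℤ x).1 hxL i
    simpa [b] using this
  choose v hv using hint
  have hvx : (fun j => (v j : ℝ)) = x := funext hv
  refine ⟨v, ?_, ?_⟩
  · rintro rfl
    apply hx0
    ext i
    simp [← hv i]
  · intro i
    rw [hvx, abs_lt]
    have := hxK i (Set.mem_univ i)
    simpa using this

open Module in
/-- Integer linear forms `ℓ i` (`i ∈ S`) have a common integral zero that is short with respect to
the coordinates given by `G⁻¹`, provided that they have small coefficients there. -/
theorem exists_short_int_vec_of_forms {ι : Type*} [Fintype ι] [DecidableEq ι] (S : Finset ι)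
    (l : ι → ι → ℤ) (G : Matrix ι ι ℝ) (t : ι → ℝ)
    (hG : G.det ≠ 0)
    (hli : ∀ c : ι → ℝ, (∀ j, ∑ i ∈ S, c i * (l i j : ℝ) = 0) → ∀ i ∈ S, c i = 0)
    (hl : ∀ i ∈ S, ∀ j, |∑ m, (l i m : ℝ) * G m j| ≤ t i)
    (hvol : (Fintype.card ι).factorial * ∏ i ∈ S, t i < |G.det|) :
    ∃ (v : ι → ℤ) (u : ι → ℝ), v ≠ 0 ∧ (∀ i, (v i : ℝ) = ∑ j, G i j * u j) ∧
      ∀ j, |u j| ≤ (Fintype.card ι - S.card : ℕ) := by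
  classical
  let a : ι → EuclideanSpace ℝ ι := fun i => WithLp.toLp 2 fun j => ∑ m, (l i m : ℝ) * G m j
  have hGu : IsUnit G.det := isUnit_iff_ne_zero.2 hG
  have ha : LinearIndependent ℝ (fun i : S => a i) := by
    rw [Fintype.linearIndependent_iff]
    intro g hg
    let c : ι → ℝ := fun i => if h : i ∈ S then g ⟨i, h⟩ else 0
    have hc : ∀ i : S, c i = g i := fun i => by simp [c]
    have h1 : Matrix.vecMul (fun j => ∑ i ∈ S, c i * (l i j : ℝ)) G = 0 := by
      ext j
      have h2 := congrArg (fun z : EuclideanSpace ℝ ι => z j) hg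
      simp only [WithLp.ofLp_sum, WithLp.ofLp_smul, Finset.sum_apply, Pi.smul_apply, smul_eq_mul,
        a, WithLp.ofLp_zero, Pi.zero_apply] at h2
      simp only [Matrix.vecMul, dotProduct, Pi.zero_apply]
      rw [← h2]
      calc ∑ m, (∑ i ∈ S, c i * (l i m : ℝ)) * G m j
          = ∑ i ∈ S, c i * ∑ m, (l i m : ℝ) * G m j := by
            simp_rw [Finset.sum_mul, Finset.mul_sum, mul_assoc]
            rw [Finset.sum_comm]
        _ = ∑ i : S, c i * ∑ m, (l i m : ℝ) * G m j :=
            (Finset.sum_coe_sort S fun i => c i * ∑ m, (l i m : ℝ) * G m j).symm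
        _ = _ := by simp_rw [hc]
    have h3 := Matrix.eq_zero_of_vecMul_eq_zero hG h1
    intro i
    rw [← hc]
    exact hli c (fun j => congrFun h3 j) i i.2
  let W := (Submodule.span ℝ (Set.range fun i : S => a i))ᗮ
  have hW : finrank ℝ W = Fintype.card {i // i ∉ S} := by
    have h1 := Submodule.finrank_add_finrank_orthogonal
      (Submodule.span ℝ (Set.range fun i : S => a i))
    rw [finrank_span_eq_card ha, finrank_euclideanSpace] at h1
    have h2 := Fintype.card_subtype_compl (fun i => i ∈ S)
    simp only [Fintype.card_coe] at h1 h2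
    change S.card + finrank ℝ W = _ at h1
    omega
  let e : OrthonormalBasis {i // i ∉ S} ℝ W :=
    (stdOrthonormalBasis ℝ W).reindex (Fintype.equivOfCardEq (by simp [hW]))
  -- The given forms in the `u`-coordinates, completed by an orthonormal basis of the orthogonal
  -- complement of their span.
  let A : Matrix ι ι ℝ := Matrix.of fun i j =>
    if h : i ∈ S then a i j else (e ⟨i, h⟩ : EuclideanSpace ℝ ι) j
  have hAS : ∀ i ∈ S, ∀ u : ι → ℝ, A.mulVec u i = inner ℝ (a i) (WithLp.toLp 2 u) := by
    intro i hi u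
    simp [A, Matrix.mulVec, dotProduct, hi, PiLp.inner_apply, mul_comm]
  have hAe : ∀ (i) (hi : i ∉ S) (u : ι → ℝ),
      A.mulVec u i = inner ℝ (e ⟨i, hi⟩ : EuclideanSpace ℝ ι) (WithLp.toLp 2 u) := by
    intro i hi u
    simp [A, Matrix.mulVec, dotProduct, hi, PiLp.inner_apply, mul_comm]
  have hmem : ∀ u : ι → ℝ, (∀ i ∈ S, A.mulVec u i = 0) → WithLp.toLp 2 u ∈ W := by
    intro u hu
    rw [Submodule.mem_orthogonal]
    intro x hx
    induction hx using Submodule.span_induction with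
    | mem x hx =>
      obtain ⟨i, rfl⟩ := hx
      rw [← hu i i.2, hAS i i.2]
    | zero => simp
    | add x y _ _ hx hy => rw [inner_add_left, hx, hy, add_zero]
    | smul c x _ hx => rw [inner_smul_left, hx, mul_zero]
  -- On the common kernel the added rows act as an isometry. This serves twice: for the
  -- invertibility of `A` and for the final bound on `u`.
  have hnorm : ∀ u : ι → ℝ, (∀ i ∈ S, A.mulVec u i = 0) →
      ∑ j, u j ^ 2 = ∑ i : {i // i ∉ S}, A.mulVec u i ^ 2 := by
    intro u hu
    have h1 := e.sum_sq_norm_inner_right ⟨_, hmem u hu⟩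
    have h2 : ‖(⟨WithLp.toLp 2 u, hmem u hu⟩ : W)‖ ^ 2 = ∑ j, u j ^ 2 := by
      rw [Submodule.coe_norm, EuclideanSpace.norm_sq_eq]
      simp
    rw [← h2, ← h1]
    refine Finset.sum_congr rfl fun i _ => ?_
    rw [hAe i i.2, Submodule.coe_inner, Real.norm_eq_abs, sq_abs]
  have hA0 : A.det ≠ 0 := by
    intro h
    obtain ⟨u, hu0, hu⟩ := Matrix.exists_mulVec_eq_zero_iff.2 h
    apply hu0
    have h1 := hnorm u fun i _ => by rw [hu]; rfl
    have h2 : ∑ j, u j ^ 2 = 0 := by rw [h1, hu]; simp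
    ext j
    have := (Finset.sum_eq_zero_iff_of_nonneg fun j _ => sq_nonneg (u j)).1 h2 j (Finset.mem_univ j)
    simpa using this
  have hAt : |A.det| ≤ (Fintype.card ι).factorial * ∏ i ∈ S, t i := by
    have hent : ∀ i j, |A i j| ≤ if i ∈ S then t i else 1 := by
      intro i j
      by_cases hi : i ∈ S
      · simpa [A, hi, a] using hl i hi j
      · have h1 : ‖(e ⟨i, hi⟩ : EuclideanSpace ℝ ι)‖ = 1 := e.norm_eq_one _
        have h2 := PiLp.norm_apply_le (e ⟨i, hi⟩ : EuclideanSpace ℝ ι) j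
        rw [h1, Real.norm_eq_abs] at h2
        simpa [A, hi] using h2
    rw [Matrix.det_apply]
    calc |∑ σ : Equiv.Perm ι, Equiv.Perm.sign σ • ∏ i, A (σ i) i|
        ≤ ∑ σ : Equiv.Perm ι, |Equiv.Perm.sign σ • ∏ i, A (σ i) i| :=
          Finset.abs_sum_le_sum_abs _ _
      _ ≤ ∑ σ : Equiv.Perm ι, ∏ i ∈ S, t i := by
          refine Finset.sum_le_sum fun σ _ => ?_
          have h1 : |Equiv.Perm.sign σ • ∏ i, A (σ i) i| = |∏ i, A (σ i) i| := by
            rcases Int.units_eq_one_or (Equiv.Perm.sign σ) with h | h <;> simp [h]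
          rw [h1, Finset.abs_prod]
          calc ∏ i, |A (σ i) i| ≤ ∏ i, (if σ i ∈ S then t (σ i) else 1) :=
                Finset.prod_le_prod (fun _ _ => abs_nonneg _) fun i _ => hent _ _
            _ = ∏ i, (if i ∈ S then t i else 1) :=
                Equiv.prod_comp σ fun i => if i ∈ S then t i else 1
            _ = _ := by simp
      _ = _ := by simp [Fintype.card_perm]
  have hdet : (A * G⁻¹).det = A.det / G.det := by
    rw [Matrix.det_mul, Matrix.det_nonsing_inv, Ring.inverse_eq_inv', div_eq_mul_inv]
  obtain ⟨v, hv0, hv⟩ := exists_int_vec_abs_mulVec_lt_one (A * G⁻¹)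
    (by rw [hdet]; exact div_ne_zero hA0 hG)
    (by rw [hdet, abs_div, div_lt_one (abs_pos.2 hG)]; exact hAt.trans_lt hvol)
  let u : ι → ℝ := G⁻¹.mulVec fun j => (v j : ℝ)
  have hGuv : G.mulVec u = fun j => (v j : ℝ) := by
    simp [u, Matrix.mulVec_mulVec, Matrix.mul_nonsing_inv _ hGu]
  have hv' : ∀ i, |A.mulVec u i| < 1 := by
    intro i
    simpa [u, Matrix.mulVec_mulVec] using hv i
  -- These entries are integers of absolute value below 1.
  have hzero : ∀ i ∈ S, A.mulVec u i = 0 := by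
    intro i hi
    have h1 : A.mulVec u i = ((∑ m, l i m * v m : ℤ) : ℝ) := by
      have h2 : A.mulVec u i = Matrix.vecMul (fun m => (l i m : ℝ)) G ⬝ᵥ u := by
        simp [A, Matrix.mulVec, hi, a, Matrix.vecMul, dotProduct]
      rw [h2, ← Matrix.dotProduct_mulVec, hGuv]
      simp [dotProduct]
    have h3 := hv' i
    rw [h1] at h3 ⊢
    have h4 : |∑ m, l i m * v m| < 1 := by exact_mod_cast h3
    rw [Int.abs_lt_one_iff.1 h4, Int.cast_zero]
  refine ⟨v, u, hv0, fun i => (congrFun hGuv i).symm, fun j => ?_⟩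
  have hcard : Fintype.card {i // i ∉ S} = Fintype.card ι - S.card := by
    rw [Fintype.card_subtype_compl (fun i => i ∈ S), Fintype.card_coe]
  have h1 : u j ^ 2 ≤ (Fintype.card ι - S.card : ℕ) := by
    calc u j ^ 2 ≤ ∑ j, u j ^ 2 :=
          Finset.single_le_sum (fun j _ => sq_nonneg (u j)) (Finset.mem_univ j)
      _ = ∑ i : {i // i ∉ S}, A.mulVec u i ^ 2 := hnorm u hzero
      _ ≤ ∑ i : {i // i ∉ S}, 1 := by
          refine Finset.sum_le_sum fun i _ => ?_
          rw [sq_le_one_iff_abs_le_one]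
          exact (hv' i).le
      _ = _ := by
          rw [Finset.sum_const, Finset.card_univ, hcard, nsmul_eq_mul, mul_one]
  -- The crude √m ≤ m avoids a square root; constants do not matter later. For m = 0 the bound
  -- forces `u = 0`.
  have h2 : ((Fintype.card ι - S.card : ℕ) : ℝ) ≤ ((Fintype.card ι - S.card : ℕ) : ℝ) ^ 2 := by
    exact_mod_cast Nat.le_self_pow two_ne_zero _
  exact abs_le_of_sq_le_sq (h1.trans h2) (Nat.cast_nonneg _)

/-! ### Sylvester families of coprime polynomials as linear forms -/

theorem Fin.prod_filter_val_lt {β : Type*} [CommMonoid β] (d m : ℕ) (h : m ≤ d) (f : ℕ → β) :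
    ∏ i ∈ (Finset.univ.filter fun i : Fin d => (i : ℕ) < m), f i = ∏ i ∈ Finset.range m, f i := by
  rw [Finset.prod_filter, Fin.prod_univ_eq_prod_range (fun i => if i < m then f i else 1) d,
    ← Finset.prod_filter]
  congr 1
  ext i
  simp only [Finset.mem_filter, Finset.mem_range]
  omega

theorem Fin.sum_filter_val_lt {β : Type*} [AddCommMonoid β] (d m : ℕ) (h : m ≤ d) (f : ℕ → β) :
    ∑ i ∈ (Finset.univ.filter fun i : Fin d => (i : ℕ) < m), f i = ∑ i ∈ Finset.range m, f i := by
  rw [Finset.sum_filter, Fin.sum_univ_eq_sum_range (fun i => if i < m then f i else 0) d,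
    ← Finset.sum_filter]
  congr 1
  ext i
  simp only [Finset.mem_filter, Finset.mem_range]
  omega

open Polynomial in
/-- The Sylvester family `X ^ i * P`, `X ^ i * Q` of coprime polynomials is independent. -/
theorem coeff_eq_zero_of_sylvester_sum_eq_zero {P Q : ℝ[X]} (h : IsCoprime P Q) {s : ℕ}
    (hs : s ≤ P.natDegree) (a b : ℕ → ℝ)
    (h0 : ∑ m ∈ Finset.range s, C (a m) * (X ^ m * P)
      + ∑ m ∈ Finset.range s, C (b m) * (X ^ m * Q) = 0) :
    ∀ m < s, a m = 0 ∧ b m = 0 := by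
  intro m hm
  have hP : P ≠ 0 := by
    rintro rfl
    simp at hs
    omega
  let A : ℝ[X] := ∑ m ∈ Finset.range s, C (a m) * X ^ m
  let B : ℝ[X] := ∑ m ∈ Finset.range s, C (b m) * X ^ m
  have hAB : A * P + B * Q = 0 := by
    simpa only [A, B, Finset.sum_mul, mul_assoc] using h0
  have hcoeff : ∀ f : ℕ → ℝ, (∑ m ∈ Finset.range s, C (f m) * X ^ m : ℝ[X]).coeff m = f m := by
    intro f
    simp [finsetSum_coeff, hm]
  -- By coprimality `P` divides `B`, whose degree is below `s ≤ P.natDegree`.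
  have hB : B = 0 := by
    have hdvd : P ∣ B := by
      refine h.dvd_of_dvd_mul_right ⟨-A, ?_⟩
      linear_combination hAB
    refine eq_zero_of_dvd_of_degree_lt hdvd ?_
    rw [degree_eq_natDegree hP]
    refine lt_of_lt_of_le ?_ (Nat.cast_le.2 hs)
    rw [degree_lt_iff_coeff_zero]
    intro i hi
    have : ¬ i < s := by exact not_lt.2 (by exact_mod_cast hi)
    simp [B, finsetSum_coeff, this]
  have hA : A = 0 := by
    rw [hB, zero_mul, add_zero] at hAB
    exact (mul_eq_zero.1 hAB).resolve_right hP
  exact ⟨by rw [← hcoeff a, show ∑ m ∈ Finset.range s, C (a m) * X ^ m = 0 from hA, coeff_zero],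
    by rw [← hcoeff b, show ∑ m ∈ Finset.range s, C (b m) * X ^ m = 0 from hB, coeff_zero]⟩

open Polynomial in
/-- Coprime polynomials with small value at `ξ` yield good simultaneous approximations of the
powers of `ξ`. -/
theorem exists_int_vec_of_coprime_polynomials {n s k : ℕ} (hs : s ≤ n) (hk : n + s = k + 1)
    {P Q : ℤ[X]} (hP : P.natDegree = n) (hQ : Q.natDegree ≤ n)
    (hcop : IsCoprime (P.map (Int.castRingHom ℝ)) (Q.map (Int.castRingHom ℝ)))
    {ξ Y δ D p q : ℝ} (hY : 0 < Y) (hδ : 0 < δ) (hD : ∀ i < s, |ξ ^ i| ≤ D)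
    (hPv : Y * (D * |aeval ξ P|) ≤ p) (hPc : ∀ i, δ * |(P.coeff i : ℝ)| ≤ p)
    (hQv : Y * (D * |aeval ξ Q|) ≤ q) (hQc : ∀ i, δ * |(Q.coeff i : ℝ)| ≤ q)
    (hvol : (k + 1).factorial * (p * q) ^ s < Y * δ ^ k) :
    ∃ v : Fin (k + 1) → ℤ, v ≠ 0 ∧ |(v 0 : ℝ)| ≤ (n - s : ℕ) * Y ∧
      ∀ j : Fin k, |ξ ^ ((j : ℕ) + 1) * (v 0 : ℝ) - (v j.succ : ℝ)| ≤ (n - s : ℕ) * δ := by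
  let S : Finset (Fin (k + 1)) := Finset.univ.filter fun i => (i : ℕ) < s + s
  let R : ℕ → ℤ[X] := fun i => if i < s then X ^ i * P else X ^ (i - s) * Q
  let l : Fin (k + 1) → Fin (k + 1) → ℤ := fun i j => (R i).coeff j
  -- The first column is Y(1, ξ, …, ξ^k), the others are δe_j. So u_0 = v_0/Y and u_j = (v_j - ξ^j
  -- v_0)/δ, while the form of a polynomial `R` gets the entries Y·R(ξ) and δ times its coefficients
  -- of index at least 1.
  let G : Matrix (Fin (k + 1)) (Fin (k + 1)) ℝ := Matrix.of fun i j =>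
    if j = 0 then Y * ξ ^ (i : ℕ) else if i = j then δ else 0
  let t : ℕ → ℝ := fun i => if i < s then p else q
  have hss : s + s ≤ k + 1 := by omega
  have hRdeg : ∀ i < s + s, (R i).natDegree < k + 1 := by
    intro i hi
    by_cases h : i < s
    · simp only [R, h, if_true]
      refine lt_of_le_of_lt natDegree_mul_le ?_
      rw [natDegree_X_pow]
      omega
    · simp only [R, h, if_false]
      refine lt_of_le_of_lt natDegree_mul_le ?_
      rw [natDegree_X_pow]
      omega
  have hRv : ∀ i < s + s, Y * |aeval ξ (R i)| ≤ t i := by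
    intro i hi
    by_cases h : i < s
    · simp only [R, t, h, if_true]
      refine le_trans ?_ hPv
      simp only [map_mul, map_pow, aeval_X, abs_mul]
      gcongr
      exact hD i h
    · simp only [R, t, h, if_false]
      refine le_trans ?_ hQv
      simp only [map_mul, map_pow, aeval_X, abs_mul]
      gcongr
      exact hD _ (by omega)
  have hp : 0 ≤ p := le_trans (by positivity) (hPc 0)
  have hq : 0 ≤ q := le_trans (by positivity) (hQc 0)
  have hRc : ∀ i j, δ * |((R i).coeff j : ℝ)| ≤ t i := by
    intro i j
    by_cases h : i < s
    · simp only [R, t, h, if_true, coeff_X_pow_mul']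
      split_ifs
      · exact hPc _
      · simpa using hp
    · simp only [R, t, h, if_false, coeff_X_pow_mul']
      split_ifs
      · exact hQc _
      · simpa using hq
  have hGdet : G.det = Y * δ ^ k := by
    rw [Matrix.det_of_isLowerTriangular, Fin.prod_univ_succ]
    · simp [G]
    · intro i j hij
      have hij' : i < j := hij
      have h1 : j ≠ 0 := (Fin.pos_iff_ne_zero.1 (lt_of_le_of_lt (Fin.zero_le _) hij'))
      simp [G, h1, hij'.ne]
  have hScard : S.card = s + s := by
    rw [Finset.card_eq_sum_ones]
    rw [Fin.sum_filter_val_lt (k + 1) (s + s) hss fun _ => 1]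
    simp
  have hli : ∀ c : Fin (k + 1) → ℝ, (∀ j, ∑ i ∈ S, c i * (l i j : ℝ) = 0) → ∀ i ∈ S, c i = 0 := by
    intro c hc
    let c' : ℕ → ℝ := fun m => if h : m < k + 1 then c ⟨m, h⟩ else 0
    have hcc : ∀ i : Fin (k + 1), c i = c' i := fun i => by
      simp only [c', dif_pos i.2, Fin.eta]
    have h1 : ∑ m ∈ Finset.range (s + s), C (c' m) * (R m).map (Int.castRingHom ℝ) = 0 := by
      ext j
      rw [finsetSum_coeff, coeff_zero]
      by_cases hj : j < k + 1
      · have h2 := hc ⟨j, hj⟩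
        simp only [hcc, l] at h2
        rw [Fin.sum_filter_val_lt (k + 1) (s + s) hss fun m => c' m * ((R m).coeff j : ℝ)] at h2
        simpa using h2
      · refine Finset.sum_eq_zero fun m hm => ?_
        have h2 := coeff_eq_zero_of_natDegree_lt
          ((hRdeg m (Finset.mem_range.1 hm)).trans_le (not_lt.1 hj))
        simp [h2]
    rw [Finset.sum_range_add] at h1
    have h2 := coeff_eq_zero_of_sylvester_sum_eq_zero hcop (s := s)
      (by rw [natDegree_map_eq_of_injective (RingHom.injective_int _), hP]; exact hs)
      c' (fun m => c' (s + m)) (by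
        rw [← h1]
        congr 1
        · refine Finset.sum_congr rfl fun m hm => ?_
          simp [R, Finset.mem_range.1 hm]
        · refine Finset.sum_congr rfl fun m hm => ?_
          simp [R])
    intro i hi
    have hi' : (i : ℕ) < s + s := by simpa [S] using hi
    rw [hcc]
    by_cases h : (i : ℕ) < s
    · exact (h2 _ h).1
    · have := (h2 (i - s) (by omega)).2
      rwa [Nat.add_sub_cancel' (not_lt.1 h)] at this
  have hl : ∀ i ∈ S, ∀ j, |∑ m, (l i m : ℝ) * G m j| ≤ t i := by
    intro i hi j
    have hi' : (i : ℕ) < s + s := by simpa [S] using hi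
    by_cases hj : j = 0
    · have h1 : ∑ m, (l i m : ℝ) * G m j = Y * aeval ξ (R i) := by
        rw [aeval_eq_sum_range' (hRdeg i hi'),
          ← Fin.sum_univ_eq_sum_range (fun m => (R i).coeff m • ξ ^ m), Finset.mul_sum]
        refine Finset.sum_congr rfl fun m _ => ?_
        simp [l, G, hj]
        ring
      rw [h1, abs_mul, abs_of_pos hY]
      exact hRv i hi'
    · have h1 : ∑ m, (l i m : ℝ) * G m j = δ * ((R i).coeff j : ℝ) := by
        simp [l, G, hj, mul_comm]
      rw [h1, abs_mul, abs_of_pos hδ]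
      exact hRc i j
  have hvol' : (Fintype.card (Fin (k + 1))).factorial * ∏ i ∈ S, t i < |G.det| := by
    rw [hGdet, Fintype.card_fin, Fin.prod_filter_val_lt (k + 1) (s + s) hss t,
      Finset.prod_range_add, abs_of_pos (by positivity)]
    convert hvol using 2
    rw [mul_pow]
    congr 1
    · rw [Finset.prod_congr rfl (fun i hi => by
        simp only [t, Finset.mem_range.1 hi, if_true] : ∀ i ∈ Finset.range s, t i = p)]
      simp
    · rw [Finset.prod_congr rfl (fun i hi => by
        simp [t] : ∀ i ∈ Finset.range s, t (s + i) = q)]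
      simp
  obtain ⟨v, u, hv0, hvu, hu⟩ := exists_short_int_vec_of_forms S l G (fun i => t i)
    (by rw [hGdet]; positivity) hli hl hvol'
  rw [Fintype.card_fin, hScard, show k + 1 - (s + s) = n - s by omega] at hu
  have hv0' : (v 0 : ℝ) = Y * u 0 := by
    rw [hvu 0, Fin.sum_univ_succ]
    simp [G]
    exact Finset.sum_eq_zero fun j _ => if_neg (Fin.succ_ne_zero j).symm
  refine ⟨v, hv0, ?_, fun j => ?_⟩
  · rw [hv0', abs_mul, abs_of_pos hY, mul_comm]
    gcongr
    exact hu 0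
  · have h1 : (v j.succ : ℝ) = Y * ξ ^ ((j : ℕ) + 1) * u 0 + δ * u j.succ := by
      rw [hvu j.succ, Fin.sum_univ_succ]
      simp [G]
    rw [h1, hv0', show ξ ^ ((j : ℕ) + 1) * (Y * u 0) - (Y * ξ ^ ((j : ℕ) + 1) * u 0 + δ * u j.succ)
      = -(u j.succ * δ) by ring, abs_neg, abs_mul, abs_of_pos hδ]
    gcongr
    exact hu _

/-! ### From small coprime pairs to simultaneous approximation -/

open Polynomial in
/-- There are pairs of coprime integer polynomials `P`, `Q` of degrees `n` and at most `n` whose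
values at `ξ` are at most `B⁻¹`, of heights `O(B ^ θ)` and `O(B ^ φ)`, for arbitrarily large `B`. -/
def HasSmallCoprimePairs (n : ℕ) (ξ θ φ : ℝ) : Prop :=
  ∃ c : ℝ, ∀ B₀ : ℝ, ∃ B ≥ B₀, ∃ P Q : ℤ[X], P.natDegree = n ∧ Q.natDegree ≤ n ∧
    IsCoprime (P.map (Int.castRingHom ℝ)) (Q.map (Int.castRingHom ℝ)) ∧
    (∀ i, |(P.coeff i : ℝ)| ≤ c * B ^ θ) ∧ |aeval ξ P| ≤ B⁻¹ ∧
    (∀ i, |(Q.coeff i : ℝ)| ≤ c * B ^ φ) ∧ |aeval ξ Q| ≤ B⁻¹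

/-- Take δ = B^(-η) and Y = B^(1+θ-η), which balances Y/B against δB^θ. As θ ≤ φ, both `P` and `Q`
then meet their bounds, and the volume condition becomes `hη` because k + 1 - 2s = n - s. -/
theorem HasSmallCoprimePairs.exists_int_vec {n s k : ℕ} (hs : s ≤ n) (hk : n + s = k + 1)
    {ξ θ φ η : ℝ} (h : HasSmallCoprimePairs n ξ θ φ) (hθφ : θ ≤ φ)
    (hη : ((n : ℝ) - s) * η < 1 + θ - s * θ - s * φ) :
    ∀ B₀ : ℝ, ∃ B ≥ B₀, ∃ v : Fin (k + 1) → ℤ, v ≠ 0 ∧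
      |(v 0 : ℝ)| ≤ (n - s : ℕ) * B ^ (1 + θ - η) ∧
      ∀ j : Fin k, |ξ ^ ((j : ℕ) + 1) * (v 0 : ℝ) - (v j.succ : ℝ)| ≤ (n - s : ℕ) * B ^ (-η) := by
  intro B₀
  obtain ⟨c, hc⟩ := h
  let D : ℝ := max 1 |ξ| ^ s
  let E : ℝ := max c D
  have hD : 0 ≤ D := by positivity
  have hE : 0 ≤ E := le_max_of_le_right hD
  have hcE : c ≤ E := le_max_left _ _
  have hDE : D ≤ E := le_max_right _ _
  -- The slack in `hη`: a factor B^ε absorbs the factorial and the height constants.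
  let ε : ℝ := 1 + θ - s * θ - s * φ - ((n : ℝ) - s) * η
  have hε : 0 < ε := sub_pos.2 hη
  have hlim := (tendsto_rpow_atTop hε).eventually_gt_atTop (((k + 1).factorial : ℝ) * (E * E) ^ s)
  obtain ⟨B₁, hB₁⟩ := eventually_atTop.1 hlim
  obtain ⟨B, hB, P, Q, hP, hQ, hcop, hPc, hPv, hQc, hQv⟩ := hc (max B₀ (max B₁ 1))
  have hB0 : B₀ ≤ B := (le_max_left _ _).trans hB
  have hB1 : B₁ ≤ B := ((le_max_left _ _).trans (le_max_right _ _)).trans hB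
  have hBone : 1 ≤ B := ((le_max_right _ _).trans (le_max_right _ _)).trans hB
  have hBpos : 0 < B := by linarith
  have hYB : B ^ (1 + θ - η) * (D * B⁻¹) = D * (B ^ (-η) * B ^ θ) := by
    rw [← Real.rpow_add hBpos, mul_left_comm, ← Real.rpow_neg_one B, ← Real.rpow_add hBpos]
    ring_nf
  have hmono : B ^ θ ≤ B ^ φ := Real.rpow_le_rpow_of_exponent_le hBone hθφ
  refine ⟨B, hB0, exists_int_vec_of_coprime_polynomials hs hk hP hQ hcop (D := D)
    (p := E * (B ^ (-η) * B ^ θ)) (q := E * (B ^ (-η) * B ^ φ)) (by positivity) (by positivity)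
    ?_ ?_ ?_ ?_ ?_ ?_⟩
  · intro i hi
    rw [abs_pow]
    calc |ξ| ^ i ≤ max 1 |ξ| ^ i := by gcongr; exact le_max_right _ _
      _ ≤ max 1 |ξ| ^ s := pow_le_pow_right₀ (le_max_left _ _) hi.le
  · calc _ ≤ B ^ (1 + θ - η) * (D * B⁻¹) := by gcongr
      _ ≤ _ := by rw [hYB]; gcongr
  · intro i
    calc _ ≤ B ^ (-η) * (c * B ^ θ) := by gcongr; exact hPc i
      _ ≤ B ^ (-η) * (E * B ^ θ) := by gcongr
      _ = _ := by ring
  · calc _ ≤ B ^ (1 + θ - η) * (D * B⁻¹) := by gcongr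
      _ ≤ _ := by rw [hYB]; gcongr
  · intro i
    calc _ ≤ B ^ (-η) * (c * B ^ φ) := by gcongr; exact hQc i
      _ ≤ B ^ (-η) * (E * B ^ φ) := by gcongr
      _ = _ := by ring
  · have hk' : (n : ℝ) + s = k + 1 := by exact_mod_cast hk
    have h1 : E * (B ^ (-η) * B ^ θ) * (E * (B ^ (-η) * B ^ φ))
        = (E * E) * B ^ (θ + φ - 2 * η) := by
      rw [show θ + φ - 2 * η = -η + θ + (-η + φ) by ring, Real.rpow_add hBpos (-η + θ),
        Real.rpow_add hBpos (-η), Real.rpow_add hBpos (-η)]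
      ring
    have h2 : B ^ (1 + θ - η) * (B ^ (-η)) ^ k = B ^ ε * (B ^ (θ + φ - 2 * η)) ^ s := by
      rw [← Real.rpow_mul_natCast hBpos.le, ← Real.rpow_mul_natCast hBpos.le,
        ← Real.rpow_add hBpos, ← Real.rpow_add hBpos]
      congr 1
      simp only [ε]
      linear_combination η * hk'
    rw [h1, h2, mul_pow, ← mul_assoc]
    gcongr
    exact hB₁ B hB1

/-- Coprime pairs of small height and value at `ξ` cannot exist, by the resultant argument. -/
theorem not_hasSmallCoprimePairs {n : ℕ} (hn : 1 ≤ n) {ξ θ φ : ℝ} (hθφ : θ ≤ φ)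
    (h : 0 < 1 + θ - n * θ - n * φ) : ¬ HasSmallCoprimePairs n ξ θ φ := by
  intro hPQ
  -- With s = n the factor n - s vanishes, so all bounds on `v` are 0.
  obtain ⟨B, -, v, hv0, h0, hj⟩ := hPQ.exists_int_vec (k := n + n - 1) (η := 0) le_rfl (by omega)
    hθφ (by simpa using h) 0
  rw [Nat.sub_self, Nat.cast_zero, zero_mul, abs_nonpos_iff, Int.cast_eq_zero] at h0
  apply hv0
  ext i
  refine Fin.cases h0 (fun j => ?_) i
  have := hj j
  rw [h0, Nat.sub_self, Nat.cast_zero, zero_mul, abs_nonpos_iff] at this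
  simpa using this

theorem le_lambdaExp {N : ℕ} {t l : ℝ}
    (h : ∃ᶠ X in atTop, SimultSolvable (veronese N t) l X) : (l : EReal) ≤ lambdaExp N t :=
  le_sSup ⟨l, h, rfl⟩

/-- Take X = rB^(1+θ-η) with r = n - s; the strict inequality `hlη` absorbs the powers of r. Since η
> 0 the errors tend to 0, so v_0 = 0 would force v = 0. -/
theorem HasSmallCoprimePairs.le_lambdaExp {n s k : ℕ} (hs : s < n) (hk : n + s = k + 1)
    {ξ θ φ η l : ℝ} (h : HasSmallCoprimePairs n ξ θ φ) (hθ : 0 < θ) (hθφ : θ ≤ φ)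
    (hη : ((n : ℝ) - s) * η < 1 + θ - s * θ - s * φ) (hl : 0 ≤ l)
    (hlη : l * (1 + θ - η) < η) : (l : EReal) ≤ lambdaExp k ξ := by
  have hsn : (s : ℝ) + 1 ≤ n := by exact_mod_cast hs
  have hs0 : (0 : ℝ) ≤ s := Nat.cast_nonneg s
  have hφ : 0 < φ := hθ.trans_le hθφ
  have hη0 : 0 < η := by
    by_contra hneg
    have : 0 ≤ l * (1 + θ - η) := mul_nonneg hl (by linarith)
    linarith
  have hη1 : η < 1 + θ := by nlinarith [mul_nonneg hs0 hθ.le, mul_nonneg hs0 hφ.le]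
  have hr : (1 : ℝ) ≤ ((n - s : ℕ) : ℝ) := by
    exact_mod_cast (by omega : 1 ≤ n - s)
  set r : ℝ := ((n - s : ℕ) : ℝ)
  have hr0 : 0 < r := by linarith
  apply _root_.le_lambdaExp
  rw [frequently_atTop]
  intro X₀
  have h1 := (tendsto_rpow_atTop (sub_pos.2 hη1)).eventually_ge_atTop X₀
  have h2 := (tendsto_rpow_atTop (sub_pos.2 hlη)).eventually_ge_atTop (r ^ l * r)
  have h3 := (tendsto_rpow_atTop hη0).eventually_gt_atTop r
  obtain ⟨B₁, hB₁⟩ := eventually_atTop.1 (h1.and (h2.and (h3.and (eventually_ge_atTop 1))))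
  obtain ⟨B, hB, v, hv0, hx, hy⟩ := h.exists_int_vec hs.le hk hθφ hη B₁
  obtain ⟨hX, hlr, hηr, hB1⟩ := hB₁ B hB
  have hBpos : 0 < B := by linarith
  have hsmall : r * B ^ (-η) < 1 := by
    rw [Real.rpow_neg hBpos.le, ← div_eq_mul_inv, div_lt_one (by positivity)]
    exact hηr
  refine ⟨r * B ^ (1 + θ - η), ?_, v 0, fun j => v j.succ, ?_, hx, fun j => ?_⟩
  · have : 0 < B ^ (1 + θ - η) := by positivity
    nlinarith
  · have hv : v 0 ≠ 0 := by
      intro h0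
      apply hv0
      ext i
      refine Fin.cases h0 (fun j => ?_) i
      have h4 := (hy j).trans_lt hsmall
      rw [h0, Int.cast_zero, mul_zero, zero_sub, abs_neg] at h4
      exact Int.abs_lt_one_iff.1 (by exact_mod_cast h4)
    exact_mod_cast Int.one_le_abs hv
  · refine (hy j).trans ?_
    rw [Real.mul_rpow hr0.le (by positivity), ← Real.rpow_mul hBpos.le, Real.rpow_neg hr0.le,
      ← div_eq_inv_mul, le_div_iff₀ (by positivity)]
    calc r * B ^ (-η) * r ^ l = (r ^ l * r) * B ^ (-η) := by ring
      _ ≤ B ^ (η - l * (1 + θ - η)) * B ^ (-η) := by gcongr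
      _ = _ := by
        rw [← Real.rpow_add hBpos]
        congr 1
        ring

/-! ### Exponents in terms of integer polynomials -/

theorem wHatExp_le_wExp {N : ℕ} (t : ℝ) : wHatExp N t ≤ wExp N t :=
  sSup_le_sSup (Set.image_mono fun _ h => Filter.Eventually.frequently h)

theorem wHatExp_nonneg {N : ℕ} (hN : 1 ≤ N) (t : ℝ) : 0 ≤ wHatExp N t := by
  refine le_sSup ⟨0, ?_, rfl⟩
  filter_upwards [eventually_ge_atTop (1 : ℝ)] with X hX
  have hsum : ∑ j : Fin N, veronese N t j * (((if (j : ℕ) = 0 then 1 else 0 : ℤ)) : ℝ) = t := by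
    rw [Finset.sum_eq_single ⟨0, hN⟩]
    · simp [veronese]
    · intro j _ hj
      have : (j : ℕ) ≠ 0 := fun h => hj (Fin.ext h)
      simp [this]
    · simp
  have h1 := Int.ceil_lt_add_one t
  have h2 := Int.le_ceil t
  have h3 : (((1 - ⌈t⌉ : ℤ)) : ℝ) + t = 1 + t - ⌈t⌉ := by push_cast; ring
  -- The value 1 + t - ⌈t⌉ lies in (0, 1], so it is nonzero even for integral `t`.
  refine ⟨1 - ⌈t⌉, fun j => if (j : ℕ) = 0 then 1 else 0, fun j => ?_, ?_, ?_⟩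
  · by_cases h : (j : ℕ) = 0
    · simpa [h] using hX
    · simp only [h, if_false, Int.cast_zero, abs_zero]
      linarith
  · rw [hsum, h3, abs_pos]
    linarith
  · rw [hsum, h3, neg_zero, Real.rpow_zero, abs_le]
    constructor <;> linarith

theorem lambdaExp_nonneg {N : ℕ} (t : ℝ) : 0 ≤ lambdaExp N t := by
  refine le_lambdaExp (l := 0) (Filter.Eventually.frequently ?_)
  filter_upwards [eventually_ge_atTop (1 : ℝ)] with X hX
  refine ⟨1, fun j => ⌊veronese N t j⌋, by simp, by simpa using hX, fun j => ?_⟩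
  rw [neg_zero, Real.rpow_zero, Int.cast_one, mul_one, abs_le]
  constructor <;> linarith [Int.floor_le (veronese N t j), Int.lt_floor_add_one (veronese N t j)]

open Polynomial in
theorem aeval_eq_coeff_zero_add_sum {N : ℕ} {R : ℤ[X]} (hR : R.natDegree ≤ N) (t : ℝ) :
    aeval t R = (R.coeff 0 : ℝ)
      + ∑ j : Fin N, veronese N t j * (R.coeff ((j : ℕ) + 1) : ℝ) := by
  rw [aeval_eq_sum_range' (Nat.lt_succ_of_le hR), Finset.sum_range_succ', add_comm,
    ← Fin.sum_univ_eq_sum_range (fun m => R.coeff (m + 1) • t ^ (m + 1))]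
  simp [veronese, mul_comm]

open Polynomial in
theorem linFormSolvable_of_polynomial {N : ℕ} {R : ℤ[X]} (hR : R.natDegree ≤ N) {t w X : ℝ}
    (hc : ∀ i, |(R.coeff i : ℝ)| ≤ X) (h0 : aeval t R ≠ 0) (hw : |aeval t R| ≤ X ^ (-w)) :
    LinFormSolvable (veronese N t) w X := by
  refine ⟨R.coeff 0, fun j => R.coeff ((j : ℕ) + 1), fun j => hc _, ?_, ?_⟩
  · rw [← aeval_eq_coeff_zero_add_sum hR]
    exact abs_pos.2 h0
  · rwa [← aeval_eq_coeff_zero_add_sum hR]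

-- The system leaves x_0 unrestricted; it is recovered as the value of the form minus the other
-- terms, and for w ≥ 0 that value is at most 1.
open Polynomial in
theorem LinFormSolvable.exists_polynomial {N : ℕ} {t w X : ℝ} (hw : 0 ≤ w) (hX : 1 ≤ X)
    (h : LinFormSolvable (veronese N t) w X) :
    ∃ R : ℤ[X], R.natDegree ≤ N ∧ (∀ i, |(R.coeff i : ℝ)| ≤ (1 + ∑ j, |veronese N t j|) * X) ∧
      aeval t R ≠ 0 ∧ |aeval t R| ≤ X ^ (-w) := by
  obtain ⟨x₀, x, hx, h0, hle⟩ := h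
  let f : ℕ → ℤ := fun i => if h : i < N + 1 then (Fin.cons x₀ x : Fin (N + 1) → ℤ) ⟨i, h⟩ else 0
  let R : ℤ[X] := ∑ i ∈ Finset.range (N + 1), C (f i) * Polynomial.X ^ i
  have hcoeff : ∀ i, R.coeff i = f i := by
    intro i
    simp only [R, finsetSum_coeff, coeff_C_mul, coeff_X_pow, mul_ite, mul_one, mul_zero,
      Finset.sum_ite_eq, Finset.mem_range]
    split_ifs with h
    · rfl
    · simp only [f, dif_neg h]
  have hf0 : f 0 = x₀ := by simp [f]
  have hfs : ∀ j : Fin N, f ((j : ℕ) + 1) = x j := by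
    intro j
    have h1 : (⟨(j : ℕ) + 1, by omega⟩ : Fin (N + 1)) = j.succ := rfl
    simp only [f, Nat.add_lt_add_iff_right, j.2, dif_pos, h1, Fin.cons_succ]
  have hdeg : R.natDegree ≤ N := by
    rw [natDegree_le_iff_coeff_eq_zero]
    intro i hi
    rw [hcoeff]
    exact dif_neg (by omega)
  have hval : aeval t R = (x₀ : ℝ) + ∑ j, veronese N t j * (x j : ℝ) := by
    rw [aeval_eq_coeff_zero_add_sum hdeg]
    simp only [hcoeff, hf0, hfs]
  have hX0 : 0 ≤ X := by linarith
  have hsum : |∑ j, veronese N t j * (x j : ℝ)| ≤ (∑ j, |veronese N t j|) * X := by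
    refine (Finset.abs_sum_le_sum_abs _ _).trans ?_
    rw [Finset.sum_mul]
    refine Finset.sum_le_sum fun j _ => ?_
    rw [abs_mul]
    gcongr
    exact hx j
  have hone : X ^ (-w) ≤ X := by
    calc X ^ (-w) ≤ 1 := Real.rpow_le_one_of_one_le_of_nonpos hX (by linarith)
      _ ≤ X := hX
  have hs0 : 0 ≤ ∑ j, |veronese N t j| := Finset.sum_nonneg fun _ _ => abs_nonneg _
  refine ⟨R, hdeg, fun i => ?_, ?_, ?_⟩
  · rw [hcoeff]
    rcases i with _ | i
    · rw [hf0, add_mul, one_mul]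
      have h1 : (x₀ : ℝ) = ((x₀ : ℝ) + ∑ j, veronese N t j * (x j : ℝ))
          - ∑ j, veronese N t j * (x j : ℝ) := by ring
      rw [h1]
      refine (abs_sub _ _).trans ?_
      exact add_le_add (hle.trans hone) hsum
    · by_cases hi : i < N
      · rw [hfs ⟨i, hi⟩]
        exact (hx _).trans (le_mul_of_one_le_left hX0 (by linarith))
      · simp only [f, show ¬ i + 1 < N + 1 by omega, dif_neg, not_false_eq_true, Int.cast_zero,
          abs_zero]
        positivity
  · rw [hval]
    exact abs_pos.1 h0
  · rwa [hval]

open Polynomial in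
theorem aeval_primPart {R : ℤ[X]} {t : ℝ} (h : aeval t R ≠ 0) :
    aeval t R.primPart ≠ 0 ∧ |aeval t R.primPart| ≤ |aeval t R| ∧
      ∀ i, |(R.primPart.coeff i : ℝ)| ≤ |(R.coeff i : ℝ)| := by
  have hR0 : R ≠ 0 := by
    rintro rfl
    simp at h
  have hc : (1 : ℝ) ≤ |(R.content : ℝ)| := by
    exact_mod_cast Int.one_le_abs (content_eq_zero_iff.not.2 hR0)
  have hR := R.eq_C_content_mul_primPart
  have hv : aeval t R = R.content * aeval t R.primPart := by
    conv_lhs => rw [hR]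
    simp
  refine ⟨fun h0 => h (by rw [hv, h0, mul_zero]), ?_, fun i => ?_⟩
  · rw [hv, abs_mul]
    exact le_mul_of_one_le_left (abs_nonneg _) hc
  · have hi : (R.coeff i : ℝ) = R.content * R.primPart.coeff i := by
      conv_lhs => rw [hR]
      simp
    rw [hi, abs_mul]
    exact le_mul_of_one_le_left (abs_nonneg _) hc

open Polynomial in
/-- A Liouville type bound for polynomials of degree at most `m`. -/
theorem exists_mahlerMeasure_rpow_le_of_wExp_lt {m : ℕ} {t a : ℝ} (h : wExp m t < a) :
    ∃ κ > 0, ∀ S : ℤ[X], S.natDegree ≤ m → aeval t S ≠ 0 →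
      κ * (S.map (Int.castRingHom ℂ)).mahlerMeasure ^ (-a) ≤ |aeval t S| := by
  have h1 : ¬ ∃ᶠ X in atTop, LinFormSolvable (veronese m t) a X := fun h2 =>
    h.not_ge (le_sSup ⟨a, h2, rfl⟩)
  obtain ⟨X₀, hX₀⟩ := eventually_atTop.1 (not_frequently.1 h1)
  -- The factor 2^m bounds coefficients by Mahler measure, and `max X₀ 1` pushes K·M past the
  -- threshold, as M ≥ 1.
  let K : ℝ := max X₀ 1 * 2 ^ m
  have hK : 0 < K := by positivity
  refine ⟨K ^ (-a), by positivity, fun S hS hv => ?_⟩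
  have hS0 : S ≠ 0 := by
    rintro rfl
    simp at hv
  have hM := one_le_mahlerMeasure_of_ne_zero hS0
  set M := (S.map (Int.castRingHom ℂ)).mahlerMeasure
  by_contra! hlt
  rw [← Real.mul_rpow hK.le (by linarith)] at hlt
  refine hX₀ (K * M) ?_ (linFormSolvable_of_polynomial hS (fun i => ?_) hv hlt.le)
  · calc X₀ ≤ max X₀ 1 := le_max_left _ _
      _ ≤ max X₀ 1 * (2 ^ m * M) := by
        refine le_mul_of_one_le_right (by positivity) ?_
        exact one_le_mul_of_one_le_of_one_le (one_le_pow₀ one_le_two) hM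
      _ = K * M := by ring
  · have h2 := norm_coeff_le_choose_mul_mahlerMeasure i (S.map (Int.castRingHom ℂ))
    have h3 : ‖(S.map (Int.castRingHom ℂ)).coeff i‖ = |(S.coeff i : ℝ)| := by
      simp
    rw [h3] at h2
    refine h2.trans ?_
    have h4 : (((S.map (Int.castRingHom ℂ)).natDegree.choose i : ℕ) : ℝ) ≤ K := by
      calc (((S.map (Int.castRingHom ℂ)).natDegree.choose i : ℕ) : ℝ)
          ≤ ((2 ^ (S.map (Int.castRingHom ℂ)).natDegree : ℕ) : ℝ) := by
            exact_mod_cast Nat.choose_le_two_pow _ _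
        _ ≤ 2 ^ m := by
            push_cast
            exact pow_le_pow_right₀ one_le_two (natDegree_map_le.trans hS)
        _ ≤ K := le_mul_of_one_le_left (by positivity) (le_max_right _ _)
    gcongr

/-! ### Irreducible polynomials and coprime pairs -/

open Polynomial in
/-- A polynomial without factorization into factors of degree below `n` has irreducible primitive
part of degree `n`. -/
theorem irreducible_primPart_of_no_factorization {n : ℕ} (hn : 1 ≤ n) {R : ℤ[X]}
    (hR : R.natDegree ≤ n)
    (h : ∀ S T : ℤ[X], R = S * T → S.natDegree ≤ n - 1 → ¬ T.natDegree ≤ n - 1) :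
    R.primPart.natDegree = n ∧ Irreducible R.primPart := by
  have hdeg : R.primPart.natDegree = n := by
    rw [natDegree_primPart]
    -- The trivial factorization 1·R already excludes degree below n.
    have := h 1 R (one_mul R).symm (by simp)
    omega
  have hprim := R.isPrimitive_primPart
  have hP0 : R.primPart ≠ 0 := hprim.ne_zero
  refine ⟨hdeg, ⟨fun hu => ?_, fun S T hST => ?_⟩⟩
  · have := natDegree_eq_zero_of_isUnit hu
    omega
  have hS0 : S ≠ 0 := by rintro rfl; exact hP0 (by rw [hST, zero_mul])
  have hT0 : T ≠ 0 := by rintro rfl; exact hP0 (by rw [hST, mul_zero])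
  have hsum : S.natDegree + T.natDegree = n := by
    rw [← natDegree_mul hS0 hT0, ← hST, hdeg]
  have hconst : ∀ U : ℤ[X], U ∣ R.primPart → U.natDegree = 0 → IsUnit U := by
    intro U hU h0
    rw [eq_C_of_natDegree_eq_zero h0] at hU ⊢
    exact isUnit_C.2 (hprim _ hU)
  by_cases hS : S.natDegree ≤ n - 1
  · left
    have hT := h (C R.content * S) T
      (by rw [mul_assoc, ← hST]; exact R.eq_C_content_mul_primPart)
      ((natDegree_C_mul_le _ _).trans hS)
    exact hconst S ⟨T, hST⟩ (by omega)
  · right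
    exact hconst T ⟨S, by rw [hST, mul_comm]⟩ (by omega)

open Polynomial in
/-- If `w_n(t) > w_{n-1}(t)`, irreducible polynomials of degree `n` achieve the exponent
`w_n(t)`. -/
theorem exists_irreducible_of_wExp_lt {n : ℕ} (hn : 2 ≤ n) {t b : ℝ}
    (hw : wExp (n - 1) t < wExp n t) (hb : b < wExp n t) :
    ∃ c : ℝ, ∀ X₀ : ℝ, ∃ X ≥ X₀, ∃ P : ℤ[X], P.natDegree = n ∧ P.IsPrimitive ∧ Irreducible P ∧
      (∀ i, |(P.coeff i : ℝ)| ≤ c * X) ∧ aeval t P ≠ 0 ∧ |aeval t P| ≤ X ^ (-b) := by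
  obtain ⟨a, ha, han⟩ := EReal.lt_iff_exists_real_btwn.1 hw
  have ha0 : 0 < a := by
    have h1 : (0 : EReal) < a :=
      ((wHatExp_nonneg (by omega) t).trans (wHatExp_le_wExp t)).trans_lt ha
    exact_mod_cast h1
  obtain ⟨_, ⟨b', hb', rfl⟩, hab⟩ := lt_sSup_iff.1 (max_lt han hb)
  have hab1 : a < b' := EReal.coe_lt_coe_iff.1 ((le_max_left _ _).trans_lt hab)
  have hbb : b < b' := EReal.coe_lt_coe_iff.1 ((le_max_right _ _).trans_lt hab)
  obtain ⟨κ, hκ, hlow⟩ := exists_mahlerMeasure_rpow_le_of_wExp_lt ha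
  let c : ℝ := 1 + ∑ j, |veronese n t j|
  have hc : 0 < c := by
    have : 0 ≤ ∑ j, |veronese n t j| := Finset.sum_nonneg fun _ _ => abs_nonneg _
    positivity
  let K : ℝ := (n + 1) * c
  have hK : 0 < K := by positivity
  refine ⟨c, fun X₀ => ?_⟩
  have hlim := (tendsto_rpow_atTop (sub_pos.2 hab1)).eventually_gt_atTop (K ^ a / (κ * κ))
  obtain ⟨X₁, hX₁⟩ := eventually_atTop.1 (hlim.and (eventually_ge_atTop 1))
  obtain ⟨X, hX, hsol⟩ := frequently_atTop.1 hb' (max X₀ X₁)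
  obtain ⟨hbig, hX1⟩ := hX₁ X ((le_max_right _ _).trans hX)
  have hXpos : 0 < X := by linarith
  obtain ⟨R, hRn, hRc, hR0, hRv⟩ := hsol.exists_polynomial (by linarith) hX1
  have hRne : R ≠ 0 := by
    rintro rfl
    simp at hR0
  have hMR : (R.map (Int.castRingHom ℂ)).mahlerMeasure ≤ K * X := by
    refine (mahlerMeasure_le_sum_norm_coeff _).trans ?_
    rw [sum_over_range' _ (fun _ => norm_zero) (n + 1)
      (Nat.lt_succ_of_le (natDegree_map_le.trans hRn))]
    calc _ ≤ ∑ i ∈ Finset.range (n + 1), c * X := by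
          refine Finset.sum_le_sum fun i _ => ?_
          rw [coeff_map, eq_intCast, Complex.norm_intCast]
          exact hRc i
      _ = K * X := by
          rw [Finset.sum_const, Finset.card_range, nsmul_eq_mul]
          push_cast
          ring
  -- Multiplying the Liouville bounds of the factors gives |R(t)| ≥ κ²M(R)^(-a), against |R(t)| ≤
  -- X^(-b') with b' > a.
  have hfac : ∀ S T : ℤ[X], R = S * T → S.natDegree ≤ n - 1 → ¬ T.natDegree ≤ n - 1 := by
    intro S T hST hS hT
    have hv : aeval t S * aeval t T = aeval t R := by rw [hST, map_mul]
    have hS0 : aeval t S ≠ 0 := fun h => hR0 (by rw [← hv, h, zero_mul])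
    have hT0 : aeval t T ≠ 0 := fun h => hR0 (by rw [← hv, h, mul_zero])
    have h1 := hlow S hS hS0
    have h2 := hlow T hT hT0
    have hM : (R.map (Int.castRingHom ℂ)).mahlerMeasure
        = (S.map (Int.castRingHom ℂ)).mahlerMeasure
          * (T.map (Int.castRingHom ℂ)).mahlerMeasure := by
      rw [hST, Polynomial.map_mul, mahlerMeasure_mul]
    have hMR0 : 0 < (R.map (Int.castRingHom ℂ)).mahlerMeasure :=
      zero_lt_one.trans_le (one_le_mahlerMeasure_of_ne_zero hRne)
    have h3 : κ * κ * (K * X) ^ (-a) ≤ X ^ (-b') := by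
      calc κ * κ * (K * X) ^ (-a)
          ≤ κ * κ * (R.map (Int.castRingHom ℂ)).mahlerMeasure ^ (-a) :=
            mul_le_mul_of_nonneg_left
              (Real.rpow_le_rpow_of_nonpos hMR0 hMR (by linarith)) (by positivity)
        _ = (κ * (S.map (Int.castRingHom ℂ)).mahlerMeasure ^ (-a))
            * (κ * (T.map (Int.castRingHom ℂ)).mahlerMeasure ^ (-a)) := by
            rw [hM, Real.mul_rpow (mahlerMeasure_nonneg _) (mahlerMeasure_nonneg _)]
            ring
        _ ≤ |aeval t S| * |aeval t T| :=
            mul_le_mul h1 h2 (mul_nonneg hκ.le (Real.rpow_nonneg (mahlerMeasure_nonneg _) _))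
              (abs_nonneg _)
        _ = |aeval t R| := by rw [← abs_mul, hv]
        _ ≤ X ^ (-b') := hRv
    rw [div_lt_iff₀ (by positivity)] at hbig
    rw [Real.mul_rpow hK.le hXpos.le, Real.rpow_neg hK.le] at h3
    have h4 : κ * κ * X ^ (-a) ≤ X ^ (-b') * K ^ a := by
      have := mul_le_mul_of_nonneg_right h3 (Real.rpow_nonneg hK.le a)
      have hKa : (K ^ a)⁻¹ * K ^ a = 1 := inv_mul_cancel₀ (by positivity)
      calc κ * κ * X ^ (-a) = κ * κ * X ^ (-a) * ((K ^ a)⁻¹ * K ^ a) := by rw [hKa, mul_one]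
        _ = κ * κ * ((K ^ a)⁻¹ * X ^ (-a)) * K ^ a := by ring
        _ ≤ _ := this
    have h5 : X ^ (-b') * K ^ a < X ^ (-b') * (X ^ (b' - a) * (κ * κ)) := by gcongr
    have h6 : X ^ (-b') * (X ^ (b' - a) * (κ * κ)) = κ * κ * X ^ (-a) := by
      rw [← mul_assoc, ← Real.rpow_add hXpos]
      ring_nf
    linarith
  obtain ⟨hPn, hPirr⟩ := irreducible_primPart_of_no_factorization (by omega) hRn hfac
  obtain ⟨hP0, hPv, hPc⟩ := aeval_primPart hR0
  refine ⟨X, (le_max_left _ _).trans hX, R.primPart, hPn, R.isPrimitive_primPart, hPirr,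
    fun i => (hPc i).trans (hRc i), hP0, hPv.trans (hRv.trans ?_)⟩
  exact Real.rpow_le_rpow_of_exponent_le hX1 (by linarith)

-- If `P` divided `Q`, the quotient would be a nonzero integer by degree, contradicting |Q(t)| <
-- |P(t)|. Gauss's lemma carries this to ℚ, where an irreducible polynomial not dividing `Q` is
-- coprime to it.
open Polynomial in
theorem isCoprime_map_of_irreducible {n : ℕ} {P Q : ℤ[X]} {t : ℝ} (hP : P.natDegree = n)
    (hQ : Q.natDegree ≤ n) (hPp : P.IsPrimitive) (hPi : Irreducible P)
    (h0 : aeval t Q ≠ 0) (hlt : |aeval t Q| < |aeval t P|) :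
    IsCoprime (P.map (Int.castRingHom ℝ)) (Q.map (Int.castRingHom ℝ)) := by
  have hnd : ¬ P ∣ Q := by
    rintro ⟨D, rfl⟩
    have hD0 : D ≠ 0 := by rintro rfl; simp at h0
    rw [natDegree_mul hPi.ne_zero hD0, hP] at hQ
    have hD := eq_C_of_natDegree_eq_zero (by omega : D.natDegree = 0)
    have hd : D.coeff 0 ≠ 0 := fun h => hD0 (by rw [hD, h, C_0])
    have hDv : aeval t D = ((D.coeff 0 : ℤ) : ℝ) := by
      conv_lhs => rw [hD]
      rw [aeval_C, algebraMap_int_eq, eq_intCast]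
    rw [map_mul, abs_mul, hDv] at hlt
    have h1 : (1 : ℝ) ≤ |((D.coeff 0 : ℤ) : ℝ)| := by exact_mod_cast Int.one_le_abs hd
    have h2 := le_mul_of_one_le_right (abs_nonneg (aeval t P)) h1
    linarith
  have hcop : IsCoprime (P.map (Int.castRingHom ℚ)) (Q.map (Int.castRingHom ℚ)) := by
    rw [((IsPrimitive.Int.irreducible_iff_irreducible_map_cast hPp).1 hPi).coprime_iff_not_dvd]
    rwa [← IsPrimitive.Int.dvd_iff_map_cast_dvd_map_cast _ _ hPp]
  have h1 := hcop.map (mapRingHom (algebraMap ℚ ℝ))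
  have h2 : (algebraMap ℚ ℝ).comp (Int.castRingHom ℚ) = Int.castRingHom ℝ := RingHom.ext_int _ _
  simpa only [coe_mapRingHom, Polynomial.map_map, h2] using h1

theorem hasSmallCoprimePairs_of_wExp_lt {n : ℕ} (hn : 2 ≤ n) {ξ b v : ℝ}
    (hw : wExp (n - 1) ξ < wExp n ξ) (hb0 : 0 < b) (hb : b < wExp n ξ)
    (hv0 : 0 < v) (hv : v < wHatExp n ξ) : HasSmallCoprimePairs n ξ b⁻¹ v⁻¹ := by
  obtain ⟨c₁, hc₁⟩ := exists_irreducible_of_wExp_lt hn hw hb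
  obtain ⟨_, ⟨v', hv', rfl⟩, hvv⟩ := lt_sSup_iff.1 hv
  have hvv' : v < v' := EReal.coe_lt_coe_iff.1 hvv
  let c₂ : ℝ := 1 + ∑ j, |veronese n ξ j|
  have hc₂ : 0 < c₂ := by
    have : 0 ≤ ∑ j, |veronese n ξ j| := Finset.sum_nonneg fun _ _ => abs_nonneg _
    positivity
  obtain ⟨Y₁, hY₁⟩ := eventually_atTop.1 (hv'.and (eventually_ge_atTop 1))
  refine ⟨max |c₁| (c₂ * 2 ^ v⁻¹), fun B₀ => ?_⟩
  obtain ⟨B₁, hB₁⟩ := eventually_atTop.1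
    ((tendsto_rpow_atTop (inv_pos.2 hv0)).eventually_ge_atTop Y₁)
  obtain ⟨X₁, hX₁⟩ := eventually_atTop.1 (((tendsto_rpow_atTop hb0).eventually_ge_atTop
    (max B₀ (max B₁ 1))).and (eventually_ge_atTop 1))
  obtain ⟨X, hX, P, hPn, hPp, hPi, hPc, hP0, hPv⟩ := hc₁ X₁
  obtain ⟨hXb, hX1⟩ := hX₁ X hX
  have hXpos : 0 < X := by linarith
  have hPpos := abs_pos.2 hP0
  -- Using the exact value at ξ, not X^b, lets the uniform exponent produce a polynomial strictly
  -- smaller than `P` at ξ.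
  set B : ℝ := |Polynomial.aeval ξ P|⁻¹ with hBdef
  have hBX : X ^ b ≤ B := by
    rw [hBdef, le_inv_comm₀ (by positivity) hPpos, ← Real.rpow_neg hXpos.le]
    exact hPv
  have hB0 : B₀ ≤ B := (le_max_left _ _).trans (hXb.trans hBX)
  have hBB₁ : B₁ ≤ B := ((le_max_left _ _).trans (le_max_right _ _)).trans (hXb.trans hBX)
  have hB1 : 1 ≤ B := ((le_max_right _ _).trans (le_max_right _ _)).trans (hXb.trans hBX)
  have hBpos : 0 < B := by linarith
  have hXB : X ≤ B ^ b⁻¹ := by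
    rw [Real.le_rpow_inv_iff_of_pos hXpos.le hBpos.le hb0]
    exact hBX
  -- The factor 2 makes the value strictly less than 1/B = |P(ξ)|.
  obtain ⟨hsol, hY1⟩ := hY₁ ((2 * B) ^ v⁻¹) (hB₁ (2 * B) (by linarith))
  set Y : ℝ := (2 * B) ^ v⁻¹ with hYdef
  obtain ⟨R, hRn, hRc, hR0, hRv⟩ := hsol.exists_polynomial (by linarith) hY1
  have hYv : Y ^ (-v') ≤ (2 * B)⁻¹ := by
    calc Y ^ (-v') ≤ Y ^ (-v) := Real.rpow_le_rpow_of_exponent_le hY1 (by linarith)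
      _ = (2 * B)⁻¹ := by
        rw [hYdef, ← Real.rpow_mul (by positivity), mul_neg, inv_mul_cancel₀ hv0.ne',
          Real.rpow_neg_one]
  have h2B : (2 * B)⁻¹ < B⁻¹ := by
    rw [inv_lt_inv₀ (by positivity) hBpos]
    linarith
  have hQB : |Polynomial.aeval ξ R| < B⁻¹ := (hRv.trans hYv).trans_lt h2B
  have hPB : |Polynomial.aeval ξ P| = B⁻¹ := by rw [hBdef, inv_inv]
  refine ⟨B, hB0, P, R, hPn, hRn, ?_, fun i => ?_, hPB.le, fun i => ?_, hQB.le⟩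
  · exact isCoprime_map_of_irreducible hPn hRn hPp hPi hR0 (by rwa [hPB])
  · calc |(P.coeff i : ℝ)| ≤ c₁ * X := hPc i
      _ ≤ |c₁| * X := by gcongr; exact le_abs_self _
      _ ≤ max |c₁| (c₂ * 2 ^ v⁻¹) * B ^ b⁻¹ := by gcongr; exact le_max_left _ _
  · calc |(R.coeff i : ℝ)| ≤ c₂ * Y := hRc i
      _ = c₂ * 2 ^ v⁻¹ * B ^ v⁻¹ := by
        rw [hYdef, Real.mul_rpow zero_le_two hBpos.le]
        ring
      _ ≤ max |c₁| (c₂ * 2 ^ v⁻¹) * B ^ v⁻¹ := by gcongr; exact le_max_right _ _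

/-- Otherwise w_n is infinite too, and θ = φ = 1/(4n) is allowed; then 1 + θ - 2nθ = 1/2 + θ > 0
contradicts `not_hasSmallCoprimePairs`. -/
theorem wHatExp_ne_top {n : ℕ} (hn : 2 ≤ n) {ξ : ℝ} (hw : wExp (n - 1) ξ < wExp n ξ) :
    wHatExp n ξ ≠ ⊤ := by
  intro htop
  have htop' : wExp n ξ = ⊤ := top_le_iff.1 (htop ▸ wHatExp_le_wExp ξ)
  have hn0 : (0 : ℝ) < n := by exact_mod_cast (by omega : 0 < n)
  have h4 : (0 : ℝ) < 4 * n := by positivity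
  refine not_hasSmallCoprimePairs (by omega) le_rfl ?_
    (hasSmallCoprimePairs_of_wExp_lt hn hw h4 (htop' ▸ EReal.coe_lt_top _) h4
      (htop ▸ EReal.coe_lt_top _))
  have h1 : (n : ℝ) * (4 * (n : ℝ))⁻¹ = 1 / 4 := by field_simp
  rw [h1]
  have : 0 < (4 * (n : ℝ))⁻¹ := by positivity
  linarith

/-! ### Optimisation of the parameters and conclusion -/

/-- The bound for `λ_k` in terms of `θ = 1 / w_n` and `φ = 1 / ŵ_n`. -/
theorem le_lambdaExp_of_wExp_lt {n s k : ℕ} (hn : 2 ≤ n) (hs : s < n) (hk : n + s = k + 1)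
    {ξ θ φ L : ℝ} (hw : wExp (n - 1) ξ < wExp n ξ) (hθ : 0 ≤ θ) (hφ : 0 < φ) (hθφ : θ ≤ φ)
    (hb : ∀ b : ℝ, 0 < b → θ < b⁻¹ → b < wExp n ξ)
    (hv : ∀ v : ℝ, 0 < v → φ < v⁻¹ → v < wHatExp n ξ)
    (hden : 0 < ((n : ℝ) - s) * (1 + θ) - (1 + θ - s * θ - s * φ))
    (hL : L * (((n : ℝ) - s) * (1 + θ) - (1 + θ - s * θ - s * φ)) ≤ 1 + θ - s * θ - s * φ) :
    (L : EReal) ≤ lambdaExp k ξ := by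
  refine EReal.ge_of_forall_gt_iff_ge.1 fun l hl => ?_
  have hl' : l < L := EReal.coe_lt_coe_iff.1 hl
  rcases lt_or_ge l 0 with hneg | hl0
  · exact le_trans (by exact_mod_cast hneg.le) (lambdaExp_nonneg ξ)
  have hr : (1 : ℝ) ≤ (n : ℝ) - s := by
    have : (s : ℝ) + 1 ≤ n := by exact_mod_cast hs
    linarith
  have hr0 : (0 : ℝ) < (n : ℝ) - s := by linarith
  have hs0 : (0 : ℝ) ≤ s := Nat.cast_nonneg s
  set r : ℝ := (n : ℝ) - s with hrdef
  set N : ℝ := 1 + θ - s * θ - s * φ with hN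
  set η : ℝ := N / r with hηdef
  have hηr : r * η = N := by
    rw [hηdef]
    field_simp
  have hgap : 0 < η - l * (1 + θ - η) := by
    have h1 : l * (r * (1 + θ) - N) < N := (mul_lt_mul_of_pos_right hl' hden).trans_le hL
    have h2 : r * (η - l * (1 + θ - η)) = N - l * (r * (1 + θ) - N) := by
      rw [← hηr]
      ring
    exact pos_of_mul_pos_right (by rw [h2]; linarith) hr0.le
  -- Raising θ and φ by ε and lowering η by 2sε uses up (c - 1)ε of the gap, so a margin of exactly
  -- ε remains.
  set c : ℝ := l * (1 + 2 * s) + 2 * s + 1 with hc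
  have hc0 : 0 < c := by positivity
  set ε : ℝ := (η - l * (1 + θ - η)) / c with hεdef
  have hε : 0 < ε := div_pos hgap hc0
  have hεc : c * ε = η - l * (1 + θ - η) := by
    rw [hεdef]
    field_simp
  have hpairs : HasSmallCoprimePairs n ξ (θ + ε) (φ + ε) := by
    have h1 : 0 < θ + ε := by linarith
    have h2 : 0 < φ + ε := by linarith
    have := hasSmallCoprimePairs_of_wExp_lt hn hw (inv_pos.2 h1)
      (hb _ (inv_pos.2 h1) (by rw [inv_inv]; linarith)) (inv_pos.2 h2)
      (hv _ (inv_pos.2 h2) (by rw [inv_inv]; linarith))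
    rwa [inv_inv, inv_inv] at this
  refine hpairs.le_lambdaExp (η := η - 2 * s * ε) hs hk (by linarith) (by linarith) ?_ hl0 ?_
  · have h1 : 0 ≤ (r - 1) * (2 * s * ε) := mul_nonneg (by linarith) (by positivity)
    rw [← hrdef]
    nlinarith
  · have h1 : l * (1 + (θ + ε) - (η - 2 * s * ε)) = η - 2 * s * ε - ε := by
      rw [hc] at hεc
      linear_combination hεc
    linarith
/-- Numbers `ξ` with `w_n(ξ) = ∞` are included; for them the bound is the limit of the
general bound as `w_n(ξ)` tends to infinity. -/
theorem mainTheorem4 (n k : ℕ) (hn : 2 ≤ n) (hnk : n ≤ k) (hk : k ≤ 2 * n - 2) (ξ : ℝ)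
    (hw : wExp (n - 1) ξ < wExp n ξ) :
    ∃ v : ℝ, wHatExp n ξ = (v : EReal) ∧
      (∀ w : ℝ, wExp n ξ = (w : EReal) →
        (((w * v + ((n : ℝ) - k - 1) * w + ((n : ℝ) - k) * v) /
          ((2 * (n : ℝ) - k - 2) * (w * v) + ((k : ℝ) - n + 1) * w + ((n : ℝ) - 1) * v) : ℝ)
            : EReal) ≤ lambdaExp k ξ) ∧
      (wExp n ξ = ⊤ →
        (((v + ((n : ℝ) - k - 1)) / ((2 * (n : ℝ) - k - 2) * v + ((k : ℝ) - n + 1)) : ℝ)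
            : EReal) ≤ lambdaExp k ξ) := by
  set s : ℕ := k + 1 - n with hsdef
  have hks : n + s = k + 1 := by omega
  have hsn : s < n := by omega
  have hs1 : (1 : ℝ) ≤ s := by exact_mod_cast (by omega : 1 ≤ s)
  have hks' : (k : ℝ) = n + s - 1 := by
    have : (n : ℝ) + s = k + 1 := by exact_mod_cast hks
    linarith
  have hsn' : (s : ℝ) + 1 ≤ n := by exact_mod_cast hsn
  have hv0 : 0 ≤ wHatExp n ξ := wHatExp_nonneg (by omega) ξ
  have hw0 : 0 < wExp n ξ :=
    ((wHatExp_nonneg (by omega) ξ).trans (wHatExp_le_wExp ξ)).trans_lt hw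
  obtain ⟨v, hv⟩ : ∃ v : ℝ, wHatExp n ξ = v :=
    ⟨(wHatExp n ξ).toReal, (EReal.coe_toReal (wHatExp_ne_top hn hw)
      (ne_bot_of_le_ne_bot EReal.zero_ne_bot hv0)).symm⟩
  have hv0' : 0 ≤ v := by
    rw [hv] at hv0
    exact_mod_cast hv0
  have hvb : 0 < v → ∀ u : ℝ, 0 < u → v⁻¹ < u⁻¹ → (u : EReal) < wHatExp n ξ := by
    intro hvpos u hu huv
    rw [hv, EReal.coe_lt_coe_iff]
    exact (inv_lt_inv₀ hvpos hu).1 huv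
  refine ⟨v, hv, fun w hwn => ?_, fun htop => ?_⟩
  · have hw0' : 0 < w := by
      rw [hwn] at hw0
      exact_mod_cast hw0
    have hvw : v ≤ w := by
      have := wHatExp_le_wExp (N := n) ξ
      rw [hv, hwn] at this
      exact_mod_cast this
    -- For ŵ_n = 0 the parameter φ = 1/ŵ_n is unavailable, but the bound is nonpositive, hence
    -- trivial.
    rcases hv0'.eq_or_lt with rfl | hvpos
    · refine le_trans ?_ (lambdaExp_nonneg ξ)
      have : (w * 0 + ((n : ℝ) - k - 1) * w + ((n : ℝ) - k) * 0) /
          ((2 * (n : ℝ) - k - 2) * (w * 0) + ((k : ℝ) - n + 1) * w + ((n : ℝ) - 1) * 0) ≤ 0 := by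
        apply div_nonpos_of_nonpos_of_nonneg
        · rw [hks']
          nlinarith
        · rw [hks']
          nlinarith
      exact_mod_cast this
    · have hN : 1 + w⁻¹ - s * w⁻¹ - s * v⁻¹
          = (w * v + ((n : ℝ) - k - 1) * w + ((n : ℝ) - k) * v) / (w * v) := by
        rw [hks']
        field_simp
        ring
      have hD : ((n : ℝ) - s) * (1 + w⁻¹) - (1 + w⁻¹ - s * w⁻¹ - s * v⁻¹)
          = ((2 * (n : ℝ) - k - 2) * (w * v) + ((k : ℝ) - n + 1) * w + ((n : ℝ) - 1) * v)
            / (w * v) := by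
        rw [hks']
        field_simp
        ring
      have hden : 0 < (2 * (n : ℝ) - k - 2) * (w * v) + ((k : ℝ) - n + 1) * w
          + ((n : ℝ) - 1) * v := by
        rw [hks']
        have h1 : 0 ≤ (n - s - 1 : ℝ) * (w * v) := mul_nonneg (by linarith) (by positivity)
        have h2 : 0 < (s : ℝ) * w := by positivity
        have h3 : 0 ≤ (n - 1 : ℝ) * v := mul_nonneg (by linarith) hv0'
        nlinarith
      have hwv : 0 < w * v := by positivity
      refine le_lambdaExp_of_wExp_lt (θ := w⁻¹) (φ := v⁻¹) hn hsn hks hw (by positivity)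
        (by positivity) (inv_anti₀ hvpos hvw) (fun b hb hbw => ?_) (hvb hvpos) ?_ ?_
      · rw [hwn, EReal.coe_lt_coe_iff]
        exact (inv_lt_inv₀ hw0' hb).1 hbw
      · rw [hD]
        positivity
      · rw [hD, hN]
        exact (div_mul_div_cancel₀ hden.ne').le
  · have hden : 0 < (2 * (n : ℝ) - k - 2) * v + ((k : ℝ) - n + 1) := by
      rw [hks']
      have h1 : 0 ≤ (n - s - 1 : ℝ) * v := mul_nonneg (by linarith) hv0'
      nlinarith
    rcases hv0'.eq_or_lt with rfl | hvpos
    · refine le_trans ?_ (lambdaExp_nonneg ξ)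
      have : (0 + ((n : ℝ) - k - 1)) / ((2 * (n : ℝ) - k - 2) * 0 + ((k : ℝ) - n + 1)) ≤ 0 := by
        apply div_nonpos_of_nonpos_of_nonneg _ hden.le
        rw [hks']
        linarith
      exact_mod_cast this
    · have hN : 1 + 0 - s * 0 - s * v⁻¹ = (v + ((n : ℝ) - k - 1)) / v := by
        rw [hks']
        field_simp
        ring
      have hD : ((n : ℝ) - s) * (1 + 0) - (1 + 0 - s * 0 - s * v⁻¹)
          = ((2 * (n : ℝ) - k - 2) * v + ((k : ℝ) - n + 1)) / v := by
        rw [hks']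
        field_simp
        ring
      -- θ = 0 encodes w_n = ∞.
      refine le_lambdaExp_of_wExp_lt (θ := 0) (φ := v⁻¹) hn hsn hks hw le_rfl
        (by positivity) (by positivity) (fun b _ _ => by rw [htop]; exact EReal.coe_lt_top b)
        (hvb hvpos) ?_ ?_
      · rw [hD]
        positivity
      · rw [hD, hN]
        exact (div_mul_div_cancel₀ hden.ne').le
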